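/- Let $(\Delta,\mathcal D,\mathbb P)$ be a probability space, and let state and input constraint sets $\mathbb X\subseteq(\mathbb R^{n_x})^{N+1}$, $\mathbb U\subseteq(\mathbb R^{n_u})^{N+1}$, dynamics $f$, an initial state $x_{\mathrm{init}}$, a stage cost $J$ and a constraint function $g$ with values in $\mathbb R^q$ be given. A decision is a pair $\theta=(x,u)$ with $x=(x_0,\dots,x_N)$, $u=(u_0,\dots,u_N)$. For $\varepsilon\in[0,1]$ consider the chance-constrained problem $$\min_{x\in\mathbb X,\,u\in\mathbb U}\ \sum_{k=0}^N J(x_k,u_k)\quad\text{s.t.}\quad x_0=x_{\mathrm{init}},\quad x_{k+1}=f(x_k,u_k)\ (0\le k<N),\quad \mathbb P[\delta : g(x,\delta)\le 0]\ge 1-\varepsilon, \tag{CCP}$$ and, for a multi-sample $\omega=(\delta^{(1)},\dots,\delta^{(m)})\in\Delta^m$, the scenario program (SP) obtained by replacing the last constraint by $g(x,\delta^{(i)})\le 0$ for $i=1,\dots,m$. Let $\mathcal A$ be a decision algorithm, which assigns a decision $\mathcal A(\omega)$ to each $\omega\in\Delta^m$, $m=0,1,2,\dots$. Assume that for every $m\ge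 1$ and every $\omega\in\Delta^m$ the decision $\mathcal A(\omega)$ is a feasible (not necessarily optimal) point of the SP for $\omega$; in particular it satisfies the constraint of every sampled scenario. Assume also that for every $m\ge 0$ the set $\{(\omega,\delta)\in\Delta^m\times\Delta : \mathcal A(\omega)=(x,u)\in\mathbb X\times\mathbb U,\ g(x,\delta)\le 0\}$ is measurable. A support subsample of $\omega=(\delta^{(1)},\dots,\delta^{(S)})$, of size $n$, is a tuple $(\delta^{(i_1)},\dots,\delta^{(i_n)})$ with $i_1<\dots<i_n$ such that $\mathcal A(\delta^{(i_1)},\dots,\delta^{(i_n)})=\mathcal A(\omega)$. Let $\varepsilon\in[0,1]$, $\beta\in(0,1)$, a support limit $\bar n\ge 0$ and a sample size $S\ge 1$ be such that $\varepsilon(\bar n)\le\varepsilon$, where $$\varepsilon(n)=\begin{cases}1-\left(\dfrac{\beta}{S\binom{S}{n}}\right)^{\frac1{S-n}}, & n\le\bar n \text{ and } n<S,\\[2mm] 1, & \text{otherwise.}\end{cases}$$ Let $\omega=(\delta^{(1)},\dots,\delta^{(S)})$ be drawn from $\mathbb P^S=\mathbb P\times\dots\times\mathbb P$. Then, with confidence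 $1-\beta$, the scenario decision $\mathcal A(\omega)$ is feasible for (CCP) whenever it has a support subsample of size $n\le\bar n$; that is, $$\mathbb P^S\bigl[\,\omega \text{ has a support subsample of size } n\le\bar n \text{ and } \mathcal A(\omega) \text{ is not feasible for (CCP)}\,\bigr]\le\beta,$$ where $\mathbb P^S$ is read as outer measure if this event is not measurable. -/

import Mathlib

/-- Data shared by the chance-constrained problem and the scenario program: horizon `N`, state and
input dimensions `nx`, `nu`, and uncertainty space `Δ`. The constraint function `g` takes values in
`ℝ^q`, and `g x δ ≤ 0` is meant componentwise. -/
structure PlanningProblem (Δ : Type*) (N nx nu q : ℕ) where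
  /-- state constraints over the horizon -/
  X : Set (Fin (N + 1) → Fin nx → ℝ)
  /-- input constraints over the horizon -/
  U : Set (Fin (N + 1) → Fin nu → ℝ)
  /-- stage cost; it plays no role in feasibility -/
  J : (Fin nx → ℝ) → (Fin nu → ℝ) → ℝ
  /-- discrete-time dynamics -/
  f : (Fin nx → ℝ) → (Fin nu → ℝ) → (Fin nx → ℝ)
  /-- initial state -/
  xinit : Fin nx → ℝ
  /-- constraint function on trajectory and uncertainty -/
  g : (Fin (N + 1) → Fin nx → ℝ) → Δ → (Fin q → ℝ)

/-- A decision `θ = (x, u)`: a state trajectory and an input trajectory. -/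
abbrev Decision (N nx nu : ℕ) : Type :=
  (Fin (N + 1) → Fin nx → ℝ) × (Fin (N + 1) → Fin nu → ℝ)

/-- A decision algorithm maps multi-samples of every finite size to decisions (for size `0`,
the decision made without any scenario). -/
abbrev DecisionAlgorithm (Δ : Type*) (N nx nu : ℕ) : Type _ :=
  (m : ℕ) → (Fin m → Δ) → Decision N nx nu

namespace PlanningProblem

variable {Δ : Type*} {N nx nu q : ℕ}

/-- The decision set `Θ = 𝕏 × 𝕌`. -/
def decisionSet (P : PlanningProblem Δ N nx nu q) : Set (Decision N nx nu) :=
  P.X ×ˢ P.U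

/-- The set `Θ_δ ⊆ Θ` of decisions that satisfy the constraint imposed by the scenario `δ`. -/
def scenarioSet (P : PlanningProblem Δ N nx nu q) (δ : Δ) : Set (Decision N nx nu) :=
  {θ | θ ∈ P.decisionSet ∧ P.g θ.1 δ ≤ 0}

/-- The constraints common to the chance-constrained problem and the scenario program: state and
input constraints, initial condition, and dynamics. -/
def NominallyFeasible (P : PlanningProblem Δ N nx nu q) (θ : Decision N nx nu) : Prop :=
  θ ∈ P.decisionSet ∧ θ.1 0 = P.xinit ∧
    ∀ k : Fin N, θ.1 k.succ = P.f (θ.1 k.castSucc) (θ.2 k.castSucc)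

/-- Feasibility for the chance-constrained problem with risk level `ε`. -/
def FeasibleCCP [MeasurableSpace Δ] (P : PlanningProblem Δ N nx nu q)
    (μ : MeasureTheory.Measure Δ) (ε : ℝ) (θ : Decision N nx nu) : Prop :=
  P.NominallyFeasible θ ∧ 1 - ε ≤ μ.real {δ | P.g θ.1 δ ≤ 0}

/-- For every sample size `m ≥ 1` and every multi-sample, the decision satisfies the constraint of
every sampled scenario. -/
def SatisfiesSampledScenarios (P : PlanningProblem Δ N nx nu q)
    (A : DecisionAlgorithm Δ N nx nu) : Prop :=
  ∀ m : ℕ, 1 ≤ m → ∀ (ω : Fin m → Δ) (i : Fin m), A m ω ∈ P.scenarioSet (ω i)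

end PlanningProblem

/-- The scenarios with indices `i 0 < i 1 < ⋯ < i (n - 1)` form a support subsample of `ω`: the
algorithm returns the same decision on them as on the whole multi-sample. -/
def IsSupportSubsample {Δ : Type*} {N nx nu : ℕ} (A : DecisionAlgorithm Δ N nx nu)
    {S : ℕ} (ω : Fin S → Δ) {n : ℕ} (i : Fin n ↪o Fin S) : Prop :=
  A n (fun j => ω (i j)) = A S ω

/-- The risk function that splits `β` evenly over the support sizes:
`1 - (β / (S * (S choose n))) ^ (1 / (S - n))` for `n ≤ nbar`, and `1` for `n > nbar`;
the value at `n = S` is always `1`. -/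
noncomputable def evenSplitRisk (β : ℝ) (S nbar n : ℕ) : ℝ :=
  if n ≤ nbar ∧ n < S then
    1 - (β / ((S : ℝ) * (S.choose n : ℝ))) ^ (1 / ((S : ℝ) - (n : ℝ)))
  else 1

/-! Fix the indices of a support subsample of size `n`. The decision depends on these `n` scenarios
only, so the other `S - n` are independent of it. If it violates the chance constraint, each of them
satisfies it with probability below `1 - ε`, so all do with probability at most `(1 - ε) ^ (S - n)`
(`pi_section_le_of_injective`). A union bound over index sets and sizes leaves the sum of `S.choose
n * (1 - ε) ^ (S - n)` over `n ≤ nbar`. The risk hypothesis bounds only the term `n = nbar`, by `β /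
S`; `choose_mul_pow_le_of_succ` passes this bound down to smaller `n`, and there are `nbar + 1 ≤ S`
terms. -/

open MeasureTheory

section Binomial

/-- The binomial coefficient is the product of `(S - i) / (j - i)` over `i < j`, and each factor is
at least `S / j`. -/
lemma pow_le_choose_mul_pow {S j : ℕ} (hjS : j ≤ S) : S ^ j ≤ S.choose j * j ^ j := by
  have hprod : S ^ j * j.factorial ≤ S.descFactorial j * j ^ j := by
    rw [← Nat.descFactorial_self j, Nat.descFactorial_eq_prod_range,
      Nat.descFactorial_eq_prod_range]
    have hconst (a : ℕ) : a ^ j = ∏ _i ∈ Finset.range j, a := by simp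
    rw [hconst S, hconst j, ← Finset.prod_mul_distrib, ← Finset.prod_mul_distrib]
    refine Finset.prod_le_prod' fun i _ => ?_
    rw [Nat.mul_sub, Nat.sub_mul, mul_comm S i]
    exact Nat.sub_le_sub_left (Nat.mul_le_mul_left i hjS) _
  rw [Nat.descFactorial_eq_factorial_mul_choose] at hprod
  exact Nat.le_of_mul_le_mul_left (by linarith) j.factorial_pos

/-- The threshold `t` with `S * (S choose n) * t ^ (S - n) ≤ β` is admissible for smaller support
sizes as well. -/
lemma choose_mul_pow_le_of_succ {S k : ℕ} (hk : k + 1 < S) {t β : ℝ} (ht : 0 ≤ t) (hβ : β ≤ 1)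
    (h : S * S.choose (k + 1) * t ^ (S - (k + 1)) ≤ β) :
    S * S.choose k * t ^ (S - k) ≤ β := by
  obtain ⟨j, rfl⟩ : ∃ j, S = k + 1 + j := ⟨S - (k + 1), by omega⟩
  have hj : 0 < j := by omega
  have hsub : k + 1 + j - (k + 1) = j := by omega
  have hsub' : k + 1 + j - k = j + 1 := by omega
  rw [hsub] at h
  rw [hsub']
  set S := k + 1 + j with hSdef
  have hS1 : (1 : ℝ) ≤ S := by exact_mod_cast (by omega : 1 ≤ S)
  have hj0 : (0 : ℝ) < j := by exact_mod_cast hj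
  have hchoose : S.choose (k + 1) = S.choose j := by
    rw [← Nat.choose_symm (by omega : j ≤ S)]; congr 1; omega
  -- The hypothesis forces `S.choose j * t ^ j ≤ 1`, while `S.choose j ≥ (S / j) ^ j`; hence `t ≤ j
  -- / S`.
  have hpow : ((S : ℝ) * t) ^ j ≤ (j : ℝ) ^ j := by
    have hSj : (S : ℝ) ^ j ≤ S.choose j * (j : ℝ) ^ j := by
      exact_mod_cast pow_le_choose_mul_pow (by omega : j ≤ S)
    have hle : (S.choose j : ℝ) * t ^ j ≤ 1 := by
      rw [hchoose] at h
      have h0 : (0 : ℝ) ≤ S.choose j * t ^ j := by positivity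
      nlinarith
    calc ((S : ℝ) * t) ^ j = (S : ℝ) ^ j * t ^ j := mul_pow _ _ _
      _ ≤ S.choose j * (j : ℝ) ^ j * t ^ j := by gcongr
      _ = S.choose j * t ^ j * (j : ℝ) ^ j := by ring
      _ ≤ 1 * (j : ℝ) ^ j := by gcongr
      _ = (j : ℝ) ^ j := one_mul _
  have hSt : (S : ℝ) * t ≤ j := le_of_pow_le_pow_left₀ hj.ne' hj0.le hpow
  have hkt : ((k : ℝ) + 1) * t ≤ j + 1 := by
    have : ((k : ℝ) + 1) ≤ S := by exact_mod_cast (by omega : k + 1 ≤ S)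
    nlinarith
  have hrec : (S.choose (k + 1) : ℝ) * (k + 1) = S.choose k * (j + 1) := by
    have := Nat.choose_succ_right_eq S k
    rw [show S - k = j + 1 by omega] at this
    exact_mod_cast this
  refine le_trans ?_ h
  -- The ratio of the term at `k` to the term at `k + 1` is `(k + 1) * t / (j + 1)`, at most 1 by
  -- `hkt`.
  have hmul : (S.choose k : ℝ) * t ≤ S.choose (k + 1) := by
    refine le_of_mul_le_mul_right ?_ (by positivity : (0 : ℝ) < j + 1)
    calc (S.choose k : ℝ) * t * (j + 1) = S.choose k * (j + 1) * t := by ring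
      _ = S.choose (k + 1) * ((k + 1) * t) := by rw [← hrec]; ring
      _ ≤ S.choose (k + 1) * (j + 1) := by gcongr
  calc (S : ℝ) * S.choose k * t ^ (j + 1) = S * (S.choose k * t) * t ^ j := by ring
    _ ≤ S * S.choose (k + 1) * t ^ j := by gcongr

lemma choose_mul_pow_le_of_le {S n nbar : ℕ} (hn : n ≤ nbar) (hS : nbar < S) {t β : ℝ}
    (ht : 0 ≤ t) (hβ : β ≤ 1) (h : S * S.choose nbar * t ^ (S - nbar) ≤ β) :
    S * S.choose n * t ^ (S - n) ≤ β := by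
  induction nbar, hn using Nat.le_induction with
  | base => exact h
  | succ k _ ih => exact ih (by omega) (choose_mul_pow_le_of_succ hS ht hβ h)

lemma sum_choose_mul_pow_le {S nbar : ℕ} (hS : nbar < S) {t β : ℝ}
    (ht : 0 ≤ t) (hβ0 : 0 ≤ β) (hβ : β ≤ 1) (h : S * S.choose nbar * t ^ (S - nbar) ≤ β) :
    ∑ n ∈ Finset.range (nbar + 1), S.choose n * t ^ (S - n) ≤ β := by
  have hS0 : (0 : ℝ) < S := by exact_mod_cast (by omega : 0 < S)
  calc ∑ n ∈ Finset.range (nbar + 1), S.choose n * t ^ (S - n)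
      ≤ ∑ _n ∈ Finset.range (nbar + 1), β / S := by
        refine Finset.sum_le_sum fun n hn => ?_
        rw [le_div_iff₀' hS0, ← mul_assoc]
        exact choose_mul_pow_le_of_le (by simpa [Nat.lt_succ_iff] using hn) hS ht hβ h
    _ = (nbar + 1) * (β / S) := by simp
    _ ≤ S * (β / S) := by
        gcongr
        exact_mod_cast hS
    _ = β := by field_simp

lemma choose_mul_pow_le_of_evenSplitRisk_le {β ε : ℝ} {S nbar : ℕ} (hβ : 0 ≤ β) (hε : ε ≤ 1)
    (hS : nbar < S) (h : evenSplitRisk β S nbar nbar ≤ ε) :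
    S * S.choose nbar * (1 - ε) ^ (S - nbar) ≤ β := by
  have hS0 : (0 : ℝ) < S := by exact_mod_cast (by omega : 0 < S)
  have hC : (0 : ℝ) < S.choose nbar := by exact_mod_cast Nat.choose_pos hS.le
  rw [evenSplitRisk, if_pos ⟨le_rfl, hS⟩] at h
  rw [← le_div_iff₀' (by positivity)]
  have hle : 1 - ε ≤ (β / (S * S.choose nbar)) ^ (1 / ((S : ℝ) - nbar)) := by linarith
  refine (pow_le_pow_left₀ (by linarith) hle _).trans_eq ?_
  rw [one_div, ← Nat.cast_sub hS.le]
  exact Real.rpow_inv_natCast_pow (by positivity) (by omega)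

end Binomial

section ProductMeasure

variable {Δ : Type*} [MeasurableSpace Δ] (μ : Measure Δ)

lemma measurePreserving_sumSplit [SigmaFinite μ] {ι κ τ : Type*} [Fintype ι] [Fintype κ]
    [Fintype τ] (e : ι ⊕ κ ≃ τ) :
    MeasurePreserving (fun ω : τ → Δ => (fun a => ω (e (.inl a)), fun b => ω (e (.inr b))))
      (Measure.pi fun _ => μ) ((Measure.pi fun _ => μ).prod (Measure.pi fun _ => μ)) :=
  (measurePreserving_sumPiEquivProdPi fun _ : ι ⊕ κ => μ).comp
    (measurePreserving_piCongrLeft (fun _ : τ => μ) e).symm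

/-- If `a` is drawn first, then the probability that `D` has `a`-section of measure at most `t` and
that all of the independent points `b k` fall into this section is at most `t ^ card κ`. -/
lemma prod_pi_section_le [IsProbabilityMeasure μ] {α κ : Type*} [MeasurableSpace α] [Fintype κ]
    (ν : Measure α) [IsProbabilityMeasure ν] {D : Set (α × Δ)} (hD : MeasurableSet D)
    (t : ENNReal) :
    (ν.prod (Measure.pi fun _ : κ => μ))
      {p | μ (Prod.mk p.1 ⁻¹' D) ≤ t ∧ ∀ k, (p.1, p.2 k) ∈ D} ≤ t ^ Fintype.card κ := by
  have hmeas : MeasurableSet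
      {p : α × (κ → Δ) | μ (Prod.mk p.1 ⁻¹' D) ≤ t ∧ ∀ k, (p.1, p.2 k) ∈ D} := by
    refine MeasurableSet.inter ?_ ?_
    · exact measurableSet_le ((measurable_measure_prodMk_left hD).comp measurable_fst)
        measurable_const
    · refine measurableSet_setOfPred.2 (Measurable.forall fun k => measurableSet_setOfPred.1 ?_)
      exact (measurable_fst.prodMk ((measurable_pi_apply k).comp measurable_snd)) hD
  rw [Measure.prod_apply hmeas]
  calc _ ≤ ∫⁻ _, t ^ Fintype.card κ ∂ν := by
        refine lintegral_mono fun a => ?_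
        by_cases ha : μ (Prod.mk a ⁻¹' D) ≤ t
        · calc _ ≤ Measure.pi (fun _ : κ => μ) (Set.univ.pi fun _ => Prod.mk a ⁻¹' D) :=
                measure_mono fun b hb k _ => hb.2 k
            _ = μ (Prod.mk a ⁻¹' D) ^ Fintype.card κ := by simp [Measure.pi_pi]
            _ ≤ t ^ Fintype.card κ := by gcongr
        · simp [ha]
    _ = t ^ Fintype.card κ := by simp

lemma pi_section_le_of_injective [IsProbabilityMeasure μ] {S n : ℕ} {i : Fin n → Fin S}
    (hi : Function.Injective i) {D : Set ((Fin n → Δ) × Δ)} (hD : MeasurableSet D)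
    (t : ENNReal) :
    Measure.pi (fun _ : Fin S => μ)
      {ω | μ (Prod.mk (fun j => ω (i j)) ⁻¹' D) ≤ t ∧ ∀ k, ((fun j => ω (i j)), ω k) ∈ D}
      ≤ t ^ (S - n) := by
  classical
  let e : Fin n ⊕ ↥(Set.range i)ᶜ ≃ Fin S :=
    (Equiv.sumCongr (Equiv.ofInjective i hi) (Equiv.refl _)).trans (Equiv.Set.sumCompl _)
  have hcard : Fintype.card ↥(Set.range i)ᶜ = S - n := by
    rw [Fintype.card_compl_set, Fintype.card_fin, Set.card_range_of_injective hi,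
      Fintype.card_fin]
  rw [← hcard]
  refine le_trans ?_ (prod_pi_section_le μ (Measure.pi fun _ : Fin n => μ) hD t)
  refine le_trans (measure_mono ?_) ((measurePreserving_sumSplit μ e).measure_preimage_le _)
  -- Membership is kept only for the indices outside the range of `i`.
  exact fun ω hω => ⟨hω.1, fun k => hω.2 k⟩

end ProductMeasure

lemma natCard_finOrderEmbedding (n S : ℕ) : Nat.card (Fin n ↪o Fin S) = S.choose n := by
  rw [Nat.card_congr Set.powersetCard.ofFinEmbEquiv, Set.powersetCard.card, Nat.card_fin]

theorem theorem1 {Δ : Type*} [MeasurableSpace Δ] (μ : MeasureTheory.Measure Δ)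
    [MeasureTheory.IsProbabilityMeasure μ] {N nx nu q : ℕ}
    (P : PlanningProblem Δ N nx nu q) (A : DecisionAlgorithm Δ N nx nu)
    -- the event that a fresh scenario is satisfied by the scenario decision is measurable
    (hmeas : ∀ m : ℕ,
      MeasurableSet {p : (Fin m → Δ) × Δ | A m p.1 ∈ P.scenarioSet p.2})
    -- the algorithm returns decisions that meet the scenario-independent constraints
    (hnom : ∀ m : ℕ, 1 ≤ m → ∀ ω : Fin m → Δ, P.NominallyFeasible (A m ω))
    -- and that satisfy every sampled scenario
    (hA : P.SatisfiesSampledScenarios A)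
    (ε β : ℝ) (hε : ε ∈ Set.Icc (0 : ℝ) 1) (hβ : β ∈ Set.Ioo (0 : ℝ) 1)
    (nbar S : ℕ) (hS : 1 ≤ S) (hrisk : evenSplitRisk β S nbar nbar ≤ ε) :
    MeasureTheory.Measure.pi (fun _ : Fin S => μ)
        {ω : Fin S → Δ |
          (∃ n : ℕ, n ≤ nbar ∧ ∃ i : Fin n ↪o Fin S, IsSupportSubsample A ω i) ∧
            ¬ P.FeasibleCCP μ ε (A S ω)}
      ≤ ENNReal.ofReal β := by
  classical
  obtain hSn | hSn := le_or_gt S nbar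
  -- Here the risk is 1, so the chance constraint is vacuous.
  · have hε1 : 1 ≤ ε := by simpa [evenSplitRisk, hSn.not_gt] using hrisk
    refine le_of_eq_of_le ?_ zero_le
    convert measure_empty (μ := Measure.pi fun _ : Fin S => μ)
    refine Set.eq_empty_of_forall_notMem fun ω hω => hω.2 ⟨hnom S hS ω, ?_⟩
    exact le_trans (by linarith) measureReal_nonneg
  have ht : 0 ≤ 1 - ε := by linarith [hε.2]
  let D (n : ℕ) : Set ((Fin n → Δ) × Δ) := {p | A n p.1 ∈ P.scenarioSet p.2}
  -- `A S ω` is replaced by the decision on the subsample, so that the section is fixed once the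
  -- coordinates in the range of `i` are.
  let E (n : ℕ) (i : Fin n ↪o Fin S) : Set (Fin S → Δ) :=
    {ω | μ (Prod.mk (fun j => ω (i j)) ⁻¹' D n) ≤ ENNReal.ofReal (1 - ε) ∧
      ∀ k, ((fun j => ω (i j)), ω k) ∈ D n}
  have hsub : {ω : Fin S → Δ |
      (∃ n : ℕ, n ≤ nbar ∧ ∃ i : Fin n ↪o Fin S, IsSupportSubsample A ω i) ∧
        ¬ P.FeasibleCCP μ ε (A S ω)} ⊆ ⋃ n ∈ Finset.range (nbar + 1), ⋃ i, E n i := by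
    rintro ω ⟨⟨n, hn, i, hi⟩, hfeas⟩
    simp only [Set.mem_iUnion]
    refine ⟨n, by simpa [Nat.lt_succ_iff] using hn, i, ?_, fun k => ?_⟩
    · have hlt : μ.real {δ | P.g (A S ω).1 δ ≤ 0} < 1 - ε :=
        lt_of_not_ge fun hge => hfeas ⟨hnom S hS ω, hge⟩
      calc μ (Prod.mk (fun j => ω (i j)) ⁻¹' D n) ≤ μ {δ | P.g (A S ω).1 δ ≤ 0} := by
            refine measure_mono fun δ hδ => ?_
            have hmem : A n (fun j => ω (i j)) ∈ P.scenarioSet δ := hδ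
            rw [show A n (fun j => ω (i j)) = A S ω from hi] at hmem
            exact hmem.2
        _ = ENNReal.ofReal (μ.real {δ | P.g (A S ω).1 δ ≤ 0}) :=
            (ofReal_measureReal (measure_ne_top _ _)).symm
        _ ≤ ENNReal.ofReal (1 - ε) := ENNReal.ofReal_le_ofReal hlt.le
    · change A n (fun j => ω (i j)) ∈ P.scenarioSet (ω k)
      rw [show A n (fun j => ω (i j)) = A S ω from hi]
      exact hA S hS ω k
  calc _ ≤ Measure.pi (fun _ : Fin S => μ) (⋃ n ∈ Finset.range (nbar + 1), ⋃ i, E n i) :=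
        measure_mono hsub
    _ ≤ ∑ n ∈ Finset.range (nbar + 1), ∑ i, Measure.pi (fun _ : Fin S => μ) (E n i) :=
        (measure_biUnion_finset_le _ _).trans
          (Finset.sum_le_sum fun n _ => measure_iUnion_fintype_le _ _)
    _ ≤ ∑ n ∈ Finset.range (nbar + 1), ∑ _i : Fin n ↪o Fin S,
          ENNReal.ofReal (1 - ε) ^ (S - n) :=
        Finset.sum_le_sum fun n _ => Finset.sum_le_sum fun i _ =>
          pi_section_le_of_injective μ i.injective (hmeas n) _
    _ = ENNReal.ofReal
          (∑ n ∈ Finset.range (nbar + 1), S.choose n * (1 - ε) ^ (S - n)) := by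
        rw [ENNReal.ofReal_sum_of_nonneg fun n _ => by positivity]
        refine Finset.sum_congr rfl fun n _ => ?_
        rw [Finset.sum_const, Finset.card_univ, ← Nat.card_eq_fintype_card,
          natCard_finOrderEmbedding, nsmul_eq_mul, ENNReal.ofReal_mul (by positivity),
          ENNReal.ofReal_natCast, ENNReal.ofReal_pow ht]
    _ ≤ ENNReal.ofReal β := ENNReal.ofReal_le_ofReal <|
        sum_choose_mul_pow_le hSn ht hβ.1.le hβ.2.le
          (choose_mul_pow_le_of_evenSplitRisk_le hβ.1.le hε.2 hSn hrisk)
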